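/- Fix an integer $d \ge 1$. Let $d\mathcal Z$ be the class of $d$ differently coloured atoms of size $1$, and for $n\ge 1$ let $\mathcal C_n = \mathrm{MSet}(\mathrm{MSet}_{1..n}(d\mathcal Z))$ be the combinatorial class of all finite multisets of multisets of $d$ coloured atoms of cardinality between $1$ and $n$; the size $|\gamma|$ of $\gamma \in \mathcal C_n$ is its total number of atoms, with multiplicity. (Its generating function is $\prod_{k=1}^n (1-z^k)^{-\binom{k+d-1}{d-1}}$.) For $\lambda \in (0,1)$ let $U_n$ be the size of an object drawn from the Boltzmann distribution $\mathbb P_\lambda(\gamma) = \lambda^{|\gamma|} / \sum_{\gamma'\in\mathcal C_n} \lambda^{|\gamma'|}$ on $\mathcal C_n$. For $r\ge 1$ and $\lambda\in(0,1)$ let $\mathrm{NegativeBinomial}(r,\lambda)$ be the distribution on $\mathbb Z_{\ge 0}$ with mass $\binom{k+r-1}{r-1}\lambda^k(1-\lambda)^r$ at $k$, and let $\mathrm{NegativeBinomial}_{\ge 1}(r,\lambda)$ be this distribution conditioned on being at least $1$. Lemma. For all sufficiently large $n$ (depending only on $d$), the equation $\mathbb E_{\lambda}[U_n] = n$ has exactly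 one solution $\lambda = \lambda_n \in (0,1)$, and the following hold. 1. For every $k \in \{1,\dots,n\}$, a random variable $V \sim \mathrm{NegativeBinomial}_{\ge 1}(d, \lambda_n^k)$ satisfies $\mathbb P(V \le n) \ge \tfrac12$. 2. Consequently the rejection loop of the multiset sampler $\Gamma\mathrm{MSet}_{1..n}(d\mathcal Z)(\lambda_n^k)$, which draws independent samples $m \sim \mathrm{NegativeBinomial}_{\ge 1}(d,\lambda_n^k)$ until $m \le n$, takes $O(1)$ trials in expectation, namely at most $2$, for every integer $k \ge 1$. -/

import Mathlib

open MeasureTheory ProbabilityTheory Filter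
open scoped ENNReal

/-- A combinatorial class: a set of objects with a size function such that there are only
finitely many objects of any given size. -/
structure CombClass where
  /-- the objects -/
  Obj : Type
  /-- the size function -/
  size : Obj → ℕ
  /-- finitely many objects of each size -/
  finite_size : ∀ m : ℕ, {a : Obj | size a = m}.Finite

namespace CombClass

/-- The class `dZ` of `d` differently coloured atoms, all of size `1`. -/
def atoms (d : ℕ) : CombClass where
  Obj := Fin d
  size := fun _ => 1
  finite_size := fun _ => Set.toFinite _

/-- The class `MSet(B)` of all finite multisets of objects of a class `B` that has no object of
size `0`; the size of a multiset is the sum of the sizes of its members, with multiplicity. -/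
def mset (B : CombClass) (hB : ∀ b : B.Obj, 0 < B.size b) : CombClass where
  Obj := Multiset B.Obj
  size := fun s => (s.map B.size).sum
  finite_size := by
    classical
    intro m
    have hT : {b : B.Obj | B.size b ≤ m}.Finite := by
      have h : {b : B.Obj | B.size b ≤ m} = ⋃ i ∈ Finset.range (m + 1), {b | B.size b = i} := by
        ext b
        simp
      rw [h]
      exact (Finset.range (m + 1)).finite_toSet.biUnion fun i _ => B.finite_size i
    refine (Set.finite_Iic (m • hT.toFinset.val)).subset ?_
    intro s hs
    have hs' : (s.map B.size).sum = m := hs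
    have hcard : Multiset.card s ≤ m := by
      have h := Multiset.card_nsmul_le_sum (s := s.map B.size) (a := 1) (by
        intro x hx
        obtain ⟨b, -, rfl⟩ := Multiset.mem_map.1 hx
        exact hB b)
      simpa [hs'] using h
    rw [Set.mem_Iic, Multiset.le_iff_count]
    intro b
    by_cases hb : b ∈ s
    · have hbm : B.size b ≤ m := hs' ▸ Multiset.single_le_sum (fun _ _ => Nat.zero_le _) _
        (Multiset.mem_map_of_mem _ hb)
      have h1 : Multiset.count b hT.toFinset.val = 1 :=
        Multiset.count_eq_one_of_mem hT.toFinset.nodup (by simpa using hbm)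
      rw [Multiset.count_nsmul, h1, mul_one]
      exact (Multiset.count_le_card b s).trans hcard
    · simp [Multiset.count_eq_zero_of_notMem hb]

/-- The subclass of the objects of `C` whose size lies in `{1, ..., n}`. -/
def sizeOneTo (C : CombClass) (n : ℕ) : CombClass where
  Obj := {a : C.Obj // 1 ≤ C.size a ∧ C.size a ≤ n}
  size := fun a => C.size a.1
  finite_size := fun m => (C.finite_size m).preimage Subtype.val_injective.injOn

/-- The ordinary generating function `C(z) = ∑_γ z ^ |γ|`, as a function of a real variable. -/
noncomputable def genFun (C : CombClass) (z : ℝ) : ℝ := ∑' γ : C.Obj, z ^ C.size γ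

/-- The Boltzmann distribution of `C` with parameter `l`: `P_l(γ) = l ^ |γ| / C(l)`. -/
noncomputable def boltzmann (C : CombClass) (l : ℝ) (γ : C.Obj) : ℝ :=
  l ^ C.size γ / C.genFun l

/-- The expected size `E_l[U]` of an object drawn from the Boltzmann distribution of `C` with
parameter `l`. -/
noncomputable def expectedSize (C : CombClass) (l : ℝ) : ℝ :=
  ∑' γ : C.Obj, (C.size γ : ℝ) * C.boltzmann l γ

/-- `MSet_{1..n}(dZ)`: the multisets of `d` coloured atoms of cardinality between `1` and `n`. -/
def summands (d n : ℕ) : CombClass :=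
  ((atoms d).mset fun _ => Nat.one_pos).sizeOneTo n

/-- `MSet(MSet_{1..n}(dZ))`: the weighted partitions into parts of size at most `n`, with
`(k + d - 1).choose (d - 1)` types of parts of size `k`. -/
def truncatedBEC (d n : ℕ) : CombClass :=
  (summands d n).mset fun b => b.2.1

end CombClass

/-- `l` is the tuned parameter `λ_n`: a parameter of the Boltzmann distribution of
`MSet(MSet_{1..n}(dZ))`, whose generating function `∏_{k ≤ n} (1 - z ^ k) ^ (-b_k)` has radius of
convergence `1` (for `n ≥ 1`), at which the expected size is `n`. -/
def IsTuned (d n : ℕ) (l : ℝ) : Prop :=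
  0 < l ∧ l < 1 ∧ (CombClass.truncatedBEC d n).expectedSize l = n

/-- The distribution `NegativeBinomial(r, l)` on `ℕ`, with mass
`(k + r - 1).choose (r - 1) * l ^ k * (1 - l) ^ r` at `k`, for `r ≥ 1`. -/
noncomputable def negativeBinomial (r : ℕ) (l : ℝ) : Measure ℕ :=
  Measure.sum fun k : ℕ =>
    ENNReal.ofReal (((k + r - 1).choose (r - 1) : ℝ) * l ^ k * (1 - l) ^ r) • Measure.dirac k

/-- The zero-truncated distribution `NegativeBinomial_{≥ 1}(r, l)`: the negative binomial
distribution conditioned on being at least `1`. -/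
noncomputable def negativeBinomialPos (r : ℕ) (l : ℝ) : Measure ℕ :=
  ProbabilityTheory.cond (negativeBinomial r l) (Set.Ici 1)

/-- The number of trials made by the loop "repeat draw `m` until `m ≤ n`" when the successive
draws are `v 0, v 1, ...`; it is `∞` if the loop does not stop. -/
noncomputable def numTrials (n : ℕ) (v : ℕ → ℕ) : ℝ≥0∞ :=
  ⨅ (i : ℕ) (_ : v i ≤ n), ((i : ℝ≥0∞) + 1)

/-! ### Expected size in a multiset class over finitely many objects -/

/-! The expected size is `∑ b, |b| z ^ |b| / (1 - z ^ |b|)` over the finitely many parts `b`: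
continuous and strictly increasing, hence a unique `λ_n`. The parts of a single colour already
contribute at least `∑_{k ≤ n} z ^ k / (1 - z)`, so tuning to `n` keeps `λ_n` away from `1`: `n (1 -
λ_n)` exceeds any constant for large `n` (`IsTuned.le_mul_one_sub`).

Put `q = λ_n ^ k`. The untruncated variable has mean `d q / (1 - q)`, so by Markov it exceeds `n`
with probability at most `q / 2` once `n (1 - q) ≥ 2 d`. It is positive with probability at least
`q`. The factors `q` cancel, so the conditioned tail is at most `1 / 2` uniformly in `k`
(`negativeBinomialPos_Ioi_le`), and the number of trials is dominated by a geometric series of sum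
`2`. -/

theorem summable_pi_prod_pow {ι : Type*} [Fintype ι] (a : ι → ℝ) (h0 : ∀ i, 0 ≤ a i)
    (h1 : ∀ i, a i < 1) : Summable fun f : ι → ℕ => ∏ i, a i ^ f i := by
  revert a
  refine Fintype.induction_empty_option (P := fun ι _ => ∀ a : ι → ℝ, (∀ i, 0 ≤ a i) →
    (∀ i, a i < 1) → Summable fun f : ι → ℕ => ∏ i, a i ^ f i) ?_ ?_ ?_ ι
  · intro α β _ e ih a h0 h1
    let := Fintype.ofEquiv β e.symm
    have := ih (fun i => a (e i)) (fun i => h0 _) fun i => h1 _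
    rw [← (Equiv.arrowCongr e (Equiv.refl ℕ)).summable_iff]
    refine this.congr fun f => ?_
    simp only [Function.comp_apply]
    rw [← e.prod_comp]
    simp
  · exact fun a _ _ => Summable.of_finite
  · intro α _ ih a h0 h1
    have h := (summable_geometric_of_lt_one (h0 none) (h1 none)).mul_of_nonneg
      (ih (fun i => a (some i)) (fun i => h0 _) fun i => h1 _)
      (fun n => pow_nonneg (h0 _) n) (fun f => Finset.prod_nonneg fun i _ => pow_nonneg (h0 _) _)
    rw [← (Equiv.piOptionEquivProd (β := fun _ : Option α => ℕ)).symm.summable_iff]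
    refine h.congr fun f => ?_
    simp [Fintype.prod_option, Equiv.piOptionEquivProd]

theorem summable_multiset_pow {ι : Type*} [Fintype ι] (w : ι → ℕ) (hw : ∀ i, 0 < w i) {z : ℝ}
    (h0 : 0 ≤ z) (h1 : z < 1) : Summable fun s : Multiset ι => z ^ (s.map w).sum := by
  classical
  have h := summable_pi_prod_pow (fun i => z ^ w i) (fun i => pow_nonneg h0 _)
    fun i => pow_lt_one₀ h0 h1 (hw i).ne'
  have h' := (Multiset.toFinsupp.toEquiv.trans
    (Finsupp.equivFunOnFinite (α := ι) (M := ℕ))).summable_iff.2 h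
  refine h'.congr fun s => ?_
  rw [Finset.sum_multiset_map_count, ← Finset.prod_pow_eq_pow_sum]
  symm
  apply Finset.prod_subset_one_on_sdiff (Finset.subset_univ _)
  · intro i hi
    have : Multiset.count i s = 0 := by simpa using hi
    simp [this]
  · intro i _
    simp [pow_mul, mul_comm]

theorem summable_multiset_mul_pow {ι : Type*} [Fintype ι] (w : ι → ℕ) (hw : ∀ i, 0 < w i) {z : ℝ}
    (h0 : 0 ≤ z) (h1 : z < 1) :
    Summable fun s : Multiset ι => ((s.map w).sum : ℝ) * z ^ (s.map w).sum := by
  -- The linear factor is absorbed by a larger radius: `m * (z / y) ^ m` is bounded in `m`, leaving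
  -- `y ^ m`.
  obtain ⟨y, hzy, hy1⟩ := exists_between h1
  have hy0 : 0 < y := h0.trans_lt hzy
  have hzy' : z / y < 1 := (div_lt_one hy0).2 hzy
  have hlim := tendsto_self_mul_const_pow_of_lt_one (div_nonneg h0 hy0.le) hzy'
  obtain ⟨C, hC⟩ := hlim.bddAbove_range
  refine Summable.of_nonneg_of_le (fun s => by positivity) (fun s => ?_)
    ((summable_multiset_pow w hw hy0.le hy1).mul_left C)
  have := hC ⟨(s.map w).sum, rfl⟩
  calc ((s.map w).sum : ℝ) * z ^ (s.map w).sum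
      = ((s.map w).sum * (z / y) ^ (s.map w).sum) * y ^ (s.map w).sum := by
        rw [mul_assoc, ← mul_pow, div_mul_cancel₀ _ hy0.ne']
    _ ≤ _ := by gcongr

/-- Removing one copy of `b` shows that the sum `S` satisfies `S = z ^ w b * (S + G)`, with `G` the
generating function; this avoids differentiating a product formula. -/
theorem hasSum_count_mul_pow {ι : Type*} [Fintype ι] [DecidableEq ι] (w : ι → ℕ)
    (hw : ∀ i, 0 < w i) {z : ℝ} (h0 : 0 ≤ z) (h1 : z < 1) (b : ι) :
    HasSum (fun s : Multiset ι => (s.count b : ℝ) * z ^ (s.map w).sum)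
      (z ^ w b / (1 - z ^ w b) * ∑' s : Multiset ι, z ^ (s.map w).sum) := by
  have hG := summable_multiset_pow w hw h0 h1
  have hS : Summable fun s : Multiset ι => (s.count b : ℝ) * z ^ (s.map w).sum := by
    refine Summable.of_nonneg_of_le (fun s => by positivity) (fun s => ?_)
      (summable_multiset_mul_pow w hw h0 h1)
    gcongr
    calc s.count b ≤ s.card := Multiset.count_le_card b s
      _ = s.card • 1 := by simp
      _ = (s.map w).card • 1 := by simp
      _ ≤ (s.map w).sum := Multiset.card_nsmul_le_sum fun x hx => by
        obtain ⟨i, -, rfl⟩ := Multiset.mem_map.1 hx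
        exact hw i
  have hinj : Function.Injective fun s : Multiset ι => b ::ₘ s :=
    fun s t h => (Multiset.cons_inj_right b).1 h
  have hshift : ∑' s : Multiset ι, (s.count b : ℝ) * z ^ (s.map w).sum
      = ∑' s : Multiset ι, ((b ::ₘ s).count b : ℝ) * z ^ ((b ::ₘ s).map w).sum := by
    refine (hinj.tsum_eq fun s hs => ?_).symm
    have hb : b ∈ s := by
      by_contra hb
      exact hs (by simp [Multiset.count_eq_zero_of_notMem hb])
    exact ⟨s.erase b, Multiset.cons_erase hb⟩
  have hstep : ∑' s : Multiset ι, (s.count b : ℝ) * z ^ (s.map w).sum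
      = z ^ w b * (∑' s : Multiset ι, (s.count b : ℝ) * z ^ (s.map w).sum
        + ∑' s : Multiset ι, z ^ (s.map w).sum) := by
    rw [← hS.tsum_add hG, ← tsum_mul_left, hshift]
    refine tsum_congr fun s => ?_
    simp only [Multiset.count_cons_self, Multiset.map_cons, Multiset.sum_cons, pow_add]
    push_cast
    ring
  have hne : 1 - z ^ w b ≠ 0 := (sub_pos.2 (pow_lt_one₀ h0 h1 (hw b).ne')).ne'
  convert! hS.hasSum using 1
  rw [div_mul_eq_mul_div, div_eq_iff hne]
  linarith

namespace CombClass

theorem expectedSize_mset (B : CombClass) [Fintype B.Obj] (hB : ∀ b : B.Obj, 0 < B.size b)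
    {z : ℝ} (h0 : 0 ≤ z) (h1 : z < 1) :
    (B.mset hB).expectedSize z = ∑ b : B.Obj, B.size b * (z ^ B.size b / (1 - z ^ B.size b)) := by
  classical
  set G := ∑' s : Multiset B.Obj, z ^ (s.map B.size).sum with hGdef
  have hG : 0 < G := by
    refine (summable_multiset_pow B.size hB h0 h1).tsum_pos (fun s => by positivity) 0 ?_
    simp
  have hsum := hasSum_sum (s := Finset.univ) fun b _ =>
    (hasSum_count_mul_pow B.size hB h0 h1 b).mul_left (B.size b : ℝ)
  have key : HasSum (fun s : Multiset B.Obj => ((s.map B.size).sum : ℝ) * z ^ (s.map B.size).sum)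
      ((∑ b : B.Obj, B.size b * (z ^ B.size b / (1 - z ^ B.size b))) * G) := by
    convert! hsum using 1
    · ext s
      have : (s.map B.size).sum = ∑ b : B.Obj, s.count b * B.size b := by
        rw [Finset.sum_multiset_map_count]
        refine Finset.sum_subset (Finset.subset_univ _) fun b _ hb => ?_
        simp [Multiset.count_eq_zero_of_notMem (by simpa using hb)]
      rw [congrArg (Nat.cast : ℕ → ℝ) this, Nat.cast_sum, Finset.sum_mul]
      refine Finset.sum_congr rfl fun b _ => ?_
      push_cast
      ring
    · rw [Finset.sum_mul]
      exact Finset.sum_congr rfl fun b _ => by ring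
  have hdiv := key.div_const G
  rw [mul_div_cancel_right₀ _ hG.ne'] at hdiv
  rw [← hdiv.tsum_eq]
  exact tsum_congr fun s => (mul_div_assoc _ _ _).symm

instance (C : CombClass) (n : ℕ) : Finite (C.sizeOneTo n).Obj := by
  have h : {a : C.Obj | 1 ≤ C.size a ∧ C.size a ≤ n}.Finite := by
    refine ((Finset.range (n + 1)).finite_toSet.biUnion fun i _ => C.finite_size i).subset ?_
    intro a ha
    simpa [Nat.lt_succ_iff] using ha.2
  exact h.to_subtype

instance (d n : ℕ) : Finite (summands d n).Obj :=
  inferInstanceAs (Finite (sizeOneTo _ n).Obj)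

noncomputable instance (d n : ℕ) : Fintype (summands d n).Obj := Fintype.ofFinite _

theorem size_pos (d n : ℕ) (b : (summands d n).Obj) : 0 < (summands d n).size b := b.2.1

theorem expectedSize_truncatedBEC (d n : ℕ) {z : ℝ} (h0 : 0 ≤ z) (h1 : z < 1) :
    (truncatedBEC d n).expectedSize z = ∑ b : (summands d n).Obj,
      (summands d n).size b * (z ^ (summands d n).size b / (1 - z ^ (summands d n).size b)) :=
  expectedSize_mset (summands d n) (size_pos d n) h0 h1

/-- The part consisting of `k + 1` atoms of the same colour. -/
def monochromatic {d : ℕ} (c : Fin d) {n : ℕ} (k : Fin n) : (summands d n).Obj :=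
  ⟨Multiset.replicate (k + 1) c, by
    simp only [mset, atoms, Multiset.map_replicate, Multiset.sum_replicate, smul_eq_mul]
    omega⟩

theorem size_monochromatic {d : ℕ} (c : Fin d) {n : ℕ} (k : Fin n) :
    (summands d n).size (monochromatic c k) = k + 1 := by
  simp [summands, sizeOneTo, monochromatic, mset, atoms, add_comm]

/-- Only the parts of one colour are kept, one of each size; Bernoulli gives `1 - z ^ k ≤ k (1 -
z)`. -/
theorem sum_le_expectedSize {d : ℕ} (hd : 1 ≤ d) (n : ℕ) {z : ℝ} (h0 : 0 ≤ z) (h1 : z < 1) :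
    ∑ k : Fin n, z ^ (k + 1 : ℕ) / (1 - z) ≤ (truncatedBEC d n).expectedSize z := by
  classical
  have hz : 0 < 1 - z := sub_pos.2 h1
  rw [expectedSize_truncatedBEC d n h0 h1]
  let c : Fin d := ⟨0, hd⟩
  have hinj : Function.Injective (monochromatic c (n := n)) := fun i j h => by
    have := congrArg (summands d n).size h
    rw [size_monochromatic, size_monochromatic] at this
    exact Fin.ext (by omega)
  have hpos : ∀ k : ℕ, 0 < k → 0 < 1 - z ^ k := fun k hk => sub_pos.2 (pow_lt_one₀ h0 h1 hk.ne')
  calc ∑ k : Fin n, z ^ (k + 1 : ℕ) / (1 - z)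
      ≤ ∑ k : Fin n, ((k + 1 : ℕ) : ℝ) * (z ^ (k + 1 : ℕ) / (1 - z ^ (k + 1 : ℕ))) := by
        refine Finset.sum_le_sum fun k _ => ?_
        have hb : 1 - z ^ (k + 1 : ℕ) ≤ ((k + 1 : ℕ) : ℝ) * (1 - z) := by
          have := one_add_mul_le_pow (a := z - 1) (by linarith) (k + 1 : ℕ)
          rw [add_sub_cancel] at this
          linarith
        rw [← mul_div_assoc, div_le_div_iff₀ hz (hpos _ k.1.succ_pos)]
        have := mul_le_mul_of_nonneg_left hb (pow_nonneg h0 (k + 1 : ℕ))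
        simp only [Nat.succ_eq_add_one]
        linarith
    _ = ∑ b ∈ Finset.univ.map ⟨monochromatic c (n := n), hinj⟩, (summands d n).size b *
          (z ^ (summands d n).size b / (1 - z ^ (summands d n).size b)) := by
        simp [size_monochromatic]
    _ ≤ _ := by
        refine Finset.sum_le_sum_of_subset_of_nonneg (Finset.subset_univ _) fun b _ _ => ?_
        have := hpos _ (size_pos d n b)
        positivity

theorem strictMonoOn_expectedSize {d n : ℕ} (hd : 1 ≤ d) (hn : 1 ≤ n) :
    StrictMonoOn (truncatedBEC d n).expectedSize (Set.Ico 0 1) := by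
  intro x hx y hy hxy
  rw [expectedSize_truncatedBEC d n hx.1 hx.2, expectedSize_truncatedBEC d n hy.1 hy.2]
  refine Finset.sum_lt_sum_of_nonempty ⟨monochromatic ⟨0, hd⟩ ⟨0, hn⟩, Finset.mem_univ _⟩
    fun b _ => ?_
  have hb := size_pos d n b
  have hpow := pow_lt_pow_left₀ hxy hx.1 hb.ne'
  have hy1 := pow_lt_one₀ hy.1 hy.2 hb.ne'
  have : (0 : ℝ) < (summands d n).size b := by exact_mod_cast hb
  refine mul_lt_mul_of_pos_left ?_ this
  rw [div_lt_div_iff₀ (by linarith) (by linarith)]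
  linarith

theorem continuousOn_expectedSize (d n : ℕ) :
    ContinuousOn (truncatedBEC d n).expectedSize (Set.Ico 0 1) := by
  refine ContinuousOn.congr ?_ fun x hx => expectedSize_truncatedBEC d n hx.1 hx.2
  refine continuousOn_finsetSum _ fun b _ => continuousOn_const.mul ?_
  refine ContinuousOn.div (by fun_prop) (by fun_prop) fun x hx => ?_
  exact (sub_pos.2 (pow_lt_one₀ hx.1 hx.2 (size_pos d n b).ne')).ne'

end CombClass

/-! ### The tuned parameter and its distance from `1` -/

open CombClass

theorem existsUnique_isTuned {d n : ℕ} (hd : 1 ≤ d) (hn : 1 ≤ n) : ∃! l : ℝ, IsTuned d n l := by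
  have hn' : (1 : ℝ) ≤ n := by exact_mod_cast hn
  -- Chosen so that `u / (1 - u) = n`: the parts of size `1` alone reach the target.
  set u : ℝ := n / (n + 1) with hu
  have hu0 : 0 ≤ u := by positivity
  have hu1 : u < 1 := (div_lt_one (by positivity)).2 (by linarith)
  have hzero : (truncatedBEC d n).expectedSize 0 = 0 := by
    rw [expectedSize_truncatedBEC d n le_rfl one_pos]
    exact Finset.sum_eq_zero fun b _ => by simp [zero_pow (size_pos d n b).ne']
  have hlarge : (n : ℝ) ≤ (truncatedBEC d n).expectedSize u := by
    refine le_trans ?_ (sum_le_expectedSize hd n hu0 hu1)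
    have h := Finset.single_le_sum (f := fun k : Fin n => u ^ (k + 1 : ℕ) / (1 - u))
      (fun k _ => div_nonneg (pow_nonneg hu0 _) (by linarith)) (Finset.mem_univ (⟨0, hn⟩ : Fin n))
    refine le_trans (le_of_eq ?_) h
    simp only [zero_add, pow_one, hu]
    field_simp
    ring
  obtain ⟨l, hl, hln⟩ := intermediate_value_Icc hu0
    ((continuousOn_expectedSize d n).mono fun x hx => ⟨hx.1, hx.2.trans_lt hu1⟩)
    (show (n : ℝ) ∈ Set.Icc _ _ from ⟨by rw [hzero]; positivity, hlarge⟩)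
  have hl0 : 0 < l := by
    refine lt_of_le_of_ne hl.1 fun h => ?_
    rw [← h, hzero] at hln
    linarith
  refine ⟨l, ⟨hl0, hl.2.trans_lt hu1, hln⟩, fun y hy => ?_⟩
  exact (strictMonoOn_expectedSize hd hn).injOn ⟨hy.1.le, hy.2.1⟩ ⟨hl0.le, hl.2.trans_lt hu1⟩
    (hy.2.2.trans hln.symm)

theorem IsTuned.le_mul_one_sub {d n : ℕ} (hd : 1 ≤ d) (C : ℕ) (hn : 2 * (2 * C + 1) * C ≤ n)
    (hn' : 2 * C + 1 ≤ n) {l : ℝ} (h : IsTuned d n l) : (C : ℝ) ≤ n * (1 - l) := by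
  obtain ⟨h0, h1, hE⟩ := h
  by_contra! hlt
  have hn0 : (0 : ℝ) < n := by exact_mod_cast (Nat.succ_pos _).trans_le hn'
  have hz : 0 < 1 - l := sub_pos.2 h1
  set K := 2 * C + 1 with hK
  -- Bernoulli: `1 - l ^ K ≤ K (1 - l)`, and `n (1 - l) < C` with `n ≥ 2 K C` makes this at most `1
  -- / 2`.
  have hpow : (1 : ℝ) / 2 ≤ l ^ K := by
    have hB := one_add_mul_le_pow (a := l - 1) (by linarith) K
    rw [add_sub_cancel] at hB
    have h2 : (2 * K * C : ℝ) ≤ n := by exact_mod_cast hn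
    have h3 : (n : ℝ) * (2 * (K * (1 - l))) ≤ n * 1 := by
      have : (0 : ℝ) ≤ K := by positivity
      nlinarith
    have := le_of_mul_le_mul_left h3 hn0
    linarith
  have hsum : (K : ℝ) * (1 / 2 / (1 - l)) ≤ n := by
    rw [← hE]
    refine le_trans ?_ (sum_le_expectedSize hd n h0.le h1)
    rw [Fin.sum_univ_eq_sum_range (fun k => l ^ (k + 1) / (1 - l)) n]
    calc (K : ℝ) * (1 / 2 / (1 - l)) = ∑ k ∈ Finset.range K, 1 / 2 / (1 - l) := by simp
      _ ≤ ∑ k ∈ Finset.range K, l ^ (k + 1) / (1 - l) := by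
        refine Finset.sum_le_sum fun k hk => ?_
        gcongr
        exact hpow.trans (pow_le_pow_of_le_one h0.le h1.le (Finset.mem_range.1 hk))
      _ ≤ _ := Finset.sum_le_sum_of_subset_of_nonneg
        (Finset.range_mono hn') fun k _ _ => by positivity
  -- This yields `n (1 - l) ≥ K / 2 = C + 1 / 2`, a contradiction.
  rw [div_div, mul_one_div, div_le_iff₀ (by positivity)] at hsum
  have : (K : ℝ) = 2 * C + 1 := by simp [hK]
  linarith

/-! ### Tail of the negative binomial distribution -/

theorem hasSum_negativeBinomial {r : ℕ} (hr : 1 ≤ r) {q : ℝ} (h0 : 0 ≤ q) (h1 : q < 1) :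
    HasSum (fun k : ℕ => ((k + r - 1).choose (r - 1) : ℝ) * q ^ k * (1 - q) ^ r) 1 := by
  obtain ⟨e, rfl⟩ : ∃ e, r = e + 1 := ⟨r - 1, by omega⟩
  have h := (hasSum_choose_mul_geometric_of_norm_lt_one e
    (r := q) (by rwa [Real.norm_of_nonneg h0])).mul_right ((1 - q) ^ (e + 1))
  have : 0 < 1 - q := sub_pos.2 h1
  rwa [one_div_mul_cancel (by positivity)] at h

/-- After dropping `k = 0`, absorbing the factor `k` into the binomial coefficient gives the series
of order `r + 1`. -/
theorem hasSum_mul_negativeBinomial {r : ℕ} (hr : 1 ≤ r) {q : ℝ} (h0 : 0 ≤ q) (h1 : q < 1) :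
    HasSum (fun k : ℕ => (k : ℝ) * (((k + r - 1).choose (r - 1) : ℝ) * q ^ k * (1 - q) ^ r))
      (r * q / (1 - q)) := by
  obtain ⟨e, rfl⟩ : ∃ e, r = e + 1 := ⟨r - 1, by omega⟩
  have h := (hasSum_choose_mul_geometric_of_norm_lt_one (e + 1)
    (r := q) (by rwa [Real.norm_of_nonneg h0])).mul_left ((e + 1) * q * (1 - q) ^ (e + 1))
  have hq : 0 < 1 - q := sub_pos.2 h1
  rw [← hasSum_nat_add_iff' 1]
  convert! h using 1
  · ext j
    have hc : ((j + 1 + e).choose e : ℝ) * (j + 1) = (j + (e + 1)).choose (e + 1) * (e + 1) := by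
      have := Nat.choose_succ_right_eq (j + (e + 1)) e
      rw [show j + (e + 1) - e = j + 1 by omega] at this
      rw [show j + 1 + e = j + (e + 1) by omega]
      exact_mod_cast this.symm
    rw [show j + 1 + (e + 1) - 1 = j + 1 + e by omega, Nat.add_sub_cancel]
    push_cast
    rw [pow_succ]
    linear_combination q ^ j * q * (1 - q) ^ (e + 1) * hc
  · simp
    field_simp
    ring

theorem negativeBinomial_weight_nonneg (r : ℕ) {q : ℝ} (h0 : 0 ≤ q) (h1 : q < 1) (k : ℕ) :
    0 ≤ ((k + r - 1).choose (r - 1) : ℝ) * q ^ k * (1 - q) ^ r := by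
  have : 0 < 1 - q := sub_pos.2 h1
  positivity

theorem isProbabilityMeasure_negativeBinomial {r : ℕ} (hr : 1 ≤ r) {q : ℝ} (h0 : 0 ≤ q)
    (h1 : q < 1) : IsProbabilityMeasure (negativeBinomial r q) := by
  constructor
  have h := hasSum_negativeBinomial hr h0 h1
  rw [negativeBinomial, Measure.sum_apply _ MeasurableSet.univ]
  simp only [Measure.smul_apply, measure_univ, smul_eq_mul, mul_one]
  rw [← ENNReal.ofReal_tsum_of_nonneg (negativeBinomial_weight_nonneg r h0 h1) h.summable,
    h.tsum_eq, ENNReal.ofReal_one]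

theorem lintegral_negativeBinomial {r : ℕ} (hr : 1 ≤ r) {q : ℝ} (h0 : 0 ≤ q) (h1 : q < 1) :
    ∫⁻ k : ℕ, (k : ℝ≥0∞) ∂negativeBinomial r q = ENNReal.ofReal (r * q / (1 - q)) := by
  have h := hasSum_mul_negativeBinomial hr h0 h1
  have hw := negativeBinomial_weight_nonneg r h0 h1
  rw [negativeBinomial, lintegral_sum_measure, ← h.tsum_eq,
    ENNReal.ofReal_tsum_of_nonneg (fun k => mul_nonneg k.cast_nonneg (hw k)) h.summable]
  refine tsum_congr fun k => ?_
  rw [lintegral_smul_measure, lintegral_dirac, ENNReal.ofReal_mul k.cast_nonneg,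
    ENNReal.ofReal_natCast, smul_eq_mul, mul_comm]

theorem le_negativeBinomial_Ici_one {r : ℕ} (hr : 1 ≤ r) {q : ℝ} (h0 : 0 ≤ q) (h1 : q < 1) :
    ENNReal.ofReal q ≤ negativeBinomial r q (Set.Ici 1) := by
  have := isProbabilityMeasure_negativeBinomial hr h0 h1
  have hset : (Set.Ici 1 : Set ℕ) = {0}ᶜ := by
    ext k
    simp [Nat.one_le_iff_ne_zero]
  have hzero : negativeBinomial r q {0} = ENNReal.ofReal ((1 - q) ^ r) := by
    rw [negativeBinomial, Measure.sum_apply _ (measurableSet_singleton _), tsum_eq_single 0]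
    · simp
    · intro k hk
      simp [hk]
  rw [hset, prob_compl_eq_one_sub (measurableSet_singleton _), hzero, ← ENNReal.ofReal_one,
    ← ENNReal.ofReal_sub _ (pow_nonneg (by linarith) _)]
  apply ENNReal.ofReal_le_ofReal
  have := pow_le_of_le_one (sub_nonneg.2 h1.le) (by linarith) (by omega : r ≠ 0)
  linarith

theorem negativeBinomialPos_Ioi_le {r n : ℕ} (hr : 1 ≤ r) {q : ℝ} (h0 : 0 < q) (h1 : q < 1)
    (hn : 2 * r ≤ (n : ℝ) * (1 - q)) : negativeBinomialPos r q (Set.Ioi n) ≤ 2⁻¹ := by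
  have := isProbabilityMeasure_negativeBinomial hr h0.le h1
  have hq : 0 < 1 - q := sub_pos.2 h1
  have hr' : (1 : ℝ) ≤ r := by exact_mod_cast hr
  have hn0 : (0 : ℝ) < n := by
    by_contra! h
    nlinarith
  have hnE : (n : ℝ≥0∞) ≠ 0 := by
    rw [Nat.cast_ne_zero]
    rintro rfl
    simp at hn0
  have htail : negativeBinomial r q (Set.Ioi n) ≤ 2⁻¹ * ENNReal.ofReal q := by
    -- Markov's inequality; the factor `q` of the mean must be kept, since it pays for the
    -- conditioning.
    have hM := mul_meas_ge_le_lintegral (μ := negativeBinomial r q)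
      (f := fun k : ℕ => (k : ℝ≥0∞)) (by fun_prop) n
    rw [lintegral_negativeBinomial hr h0.le h1] at hM
    have hsub : Set.Ioi n ⊆ {k : ℕ | (n : ℝ≥0∞) ≤ k} := fun k hk => by
      have : n < k := hk
      simpa using this.le
    have hle : ENNReal.ofReal (r * q / (1 - q)) ≤ n * (2⁻¹ * ENNReal.ofReal q) := by
      rw [← ENNReal.ofReal_natCast n, show (2⁻¹ : ℝ≥0∞) = ENNReal.ofReal 2⁻¹ by
        rw [ENNReal.ofReal_inv_of_pos two_pos]; simp, ← ENNReal.ofReal_mul (by positivity),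
        ← ENNReal.ofReal_mul n.cast_nonneg]
      apply ENNReal.ofReal_le_ofReal
      rw [div_le_iff₀ hq]
      nlinarith
    have := ((mul_le_mul_right (measure_mono hsub) (n : ℝ≥0∞)).trans hM).trans hle
    exact (ENNReal.mul_le_mul_iff_right hnE (ENNReal.natCast_ne_top n)).1 this
  rw [negativeBinomialPos, cond_apply measurableSet_Ici]
  calc _ ≤ (negativeBinomial r q (Set.Ici 1))⁻¹ * (2⁻¹ * negativeBinomial r q (Set.Ici 1)) := by
        gcongr
        exact (measure_mono Set.inter_subset_right).trans
          (htail.trans (by gcongr; exact le_negativeBinomial_Ici_one hr h0.le h1))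
    _ = 2⁻¹ * ((negativeBinomial r q (Set.Ici 1))⁻¹ * negativeBinomial r q (Set.Ici 1)) := by ring
    _ ≤ 2⁻¹ * 1 := by
        gcongr
        exact ENNReal.inv_mul_le_one _
    _ = 2⁻¹ := mul_one _

/-! ### The rejection loop -/

/-- Tail-sum formula: the `j`-th indicator says that the first `j` draws all fail, so trial `j + 1`
takes place. The term `j = 0` is always `1`. -/
theorem numTrials_le_tsum (n : ℕ) (v : ℕ → ℕ) :
    numTrials n v ≤ ∑' j : ℕ, (⋂ i ∈ Finset.range j, {u : ℕ → ℕ | n < u i}).indicator 1 v := by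
  classical
  by_cases h : ∃ i, v i ≤ n
  · have hind : ∀ j ∈ Finset.range (Nat.find h + 1),
        (⋂ i ∈ Finset.range j, {u : ℕ → ℕ | n < u i}).indicator (1 : (ℕ → ℕ) → ℝ≥0∞) v = 1 := by
      intro j hj
      refine Set.indicator_of_mem ?_ _
      simp only [Set.mem_iInter, Finset.mem_range, Set.mem_ofPred_eq] at hj ⊢
      exact fun i hi => not_le.1 (Nat.find_min h (by omega))
    calc numTrials n v ≤ (Nat.find h : ℝ≥0∞) + 1 :=
        iInf₂_le (f := fun i (_ : v i ≤ n) => (i : ℝ≥0∞) + 1) _ (Nat.find_spec h)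
      _ = ∑ j ∈ Finset.range (Nat.find h + 1),
          (⋂ i ∈ Finset.range j, {u : ℕ → ℕ | n < u i}).indicator 1 v := by
        rw [Finset.sum_congr rfl hind]
        simp
      _ ≤ _ := ENNReal.sum_le_tsum _
  · push Not at h
    have hind : ∀ j, (⋂ i ∈ Finset.range j, {u : ℕ → ℕ | n < u i}).indicator
        (1 : (ℕ → ℕ) → ℝ≥0∞) v = 1 :=
      fun j => Set.indicator_of_mem (by simpa using fun i _ => h i) _
    simp only [hind]
    rw [ENNReal.tsum_const_eq_top_of_ne_zero one_ne_zero]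
    exact le_top

theorem lintegral_numTrials_le {Ω : Type*} [MeasurableSpace Ω] {P : Measure Ω} {n : ℕ}
    {V : ℕ → Ω → ℕ} (hV : ∀ i, AEMeasurable (V i) P) (hind : iIndepFun V P)
    (htail : ∀ i, P {ω | n < V i ω} ≤ 2⁻¹) :
    ∫⁻ ω, numTrials n (fun i => V i ω) ∂P ≤ 2 := by
  have hmeas : ∀ j : ℕ, NullMeasurableSet (⋂ i ∈ Finset.range j, V i ⁻¹' Set.Ioi n) P := fun j =>
    Finset.nullMeasurableSet_biInter _ fun i _ => (hV i).nullMeasurable measurableSet_Ioi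
  calc ∫⁻ ω, numTrials n (fun i => V i ω) ∂P
      ≤ ∫⁻ ω, ∑' j : ℕ, (⋂ i ∈ Finset.range j, V i ⁻¹' Set.Ioi n).indicator 1 ω ∂P := by
        refine lintegral_mono fun ω => (numTrials_le_tsum n _).trans (le_of_eq ?_)
        refine tsum_congr fun j => ?_
        classical
        simp only [Set.indicator_apply, Set.mem_iInter, Set.mem_ofPred_eq, Set.mem_preimage,
          Set.mem_Ioi, Pi.one_apply]
    _ = ∑' j : ℕ, P (⋂ i ∈ Finset.range j, V i ⁻¹' Set.Ioi n) := by
        refine (lintegral_tsum fun j => (aemeasurable_const (b := (1 : ℝ≥0∞))).indicator₀ (hmeas j)).trans ?_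
        exact tsum_congr fun j => lintegral_indicator_one₀ (hmeas j)
    _ ≤ ∑' j : ℕ, 2⁻¹ ^ j := by
        refine ENNReal.tsum_le_tsum fun j => ?_
        rw [hind.measure_inter_preimage_eq_mul (Finset.range j) (sets := fun _ => Set.Ioi n)
          fun i _ => measurableSet_Ioi]
        calc _ ≤ ∏ i ∈ Finset.range j, (2⁻¹ : ℝ≥0∞) :=
              Finset.prod_le_prod' fun i _ => htail i
          _ = _ := by simp
    _ = 2 := by
        rw [ENNReal.tsum_geometric, ENNReal.one_sub_inv_two, inv_inv]

theorem mainTheorem5 (d : ℕ) (hd : 1 ≤ d) :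
    ∀ᶠ n : ℕ in atTop,
      (∃! l : ℝ, IsTuned d n l) ∧
      ∀ l : ℝ, IsTuned d n l →
        (∀ k ∈ Finset.Icc 1 n,
          ∀ (Ω : Type*) [MeasurableSpace Ω] (P : Measure Ω) [IsProbabilityMeasure P] (V : Ω → ℕ),
            HasLaw V (negativeBinomialPos d (l ^ k)) P →
            1 / 2 ≤ P.real {ω | V ω ≤ n}) ∧
        (∀ k : ℕ, 1 ≤ k →
          ∀ (Ω : Type*) [MeasurableSpace Ω] (P : Measure Ω) [IsProbabilityMeasure P]
            (V : ℕ → Ω → ℕ),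
            (∀ i, HasLaw (V i) (negativeBinomialPos d (l ^ k)) P) → iIndepFun V P →
            ∫⁻ ω, numTrials n (fun i => V i ω) ∂P ≤ 2) := by
  -- The thresholds of `IsTuned.le_mul_one_sub` at `C = 2 * d`, the gap needed for the tail bound.
  filter_upwards [eventually_ge_atTop (2 * (2 * (2 * d) + 1) * (2 * d)),
    eventually_ge_atTop (2 * (2 * d) + 1)] with n hn hn'
  refine ⟨existsUnique_isTuned hd (by omega), fun l hl => ?_⟩
  have htail : ∀ k : ℕ, 1 ≤ k → negativeBinomialPos d (l ^ k) (Set.Ioi n) ≤ 2⁻¹ := by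
    intro k hk
    obtain ⟨h0, h1, -⟩ := id hl
    have hgap := hl.le_mul_one_sub hd (2 * d) hn hn'
    -- The gap at `k = 1` thus serves every `k ≥ 1`, including `k > n`.
    have hle : l ^ k ≤ l := pow_le_of_le_one h0.le h1.le (by omega)
    refine negativeBinomialPos_Ioi_le hd (pow_pos h0 k) (hle.trans_lt h1) ?_
    push_cast at hgap
    exact hgap.trans (by gcongr)
  refine ⟨fun k hk Ω _ P _ V hV => ?_, fun k hk Ω _ P _ V hV hind => ?_⟩
  · have h := htail k (Finset.mem_Icc.1 hk).1
    have hgt : P.real (V ⁻¹' Set.Ioi n) ≤ 2⁻¹ := by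
      rw [← map_measureReal_apply_of_aemeasurable hV.aemeasurable measurableSet_Ioi, hV.map_eq]
      exact (ENNReal.toReal_mono (by simp) h).trans_eq (by simp)
    have hcompl : {ω | V ω ≤ n} = (V ⁻¹' Set.Ioi n)ᶜ := by
      ext
      simp
    rw [hcompl, probReal_compl_eq_one_sub₀ (hV.aemeasurable.nullMeasurable measurableSet_Ioi)]
    linarith
  · refine lintegral_numTrials_le (fun i => (hV i).aemeasurable) hind fun i => ?_
    rw [(hV i).measure_eq measurableSet_Ioi]
    exact htail k hk
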